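/- Theorem 2.1. For a set $K\subset\mathbb C$ and $\delta>0$ put $K_\delta=\{z\in\mathbb C : \operatorname{dist}(z,K)\le\delta\}$ (with $\emptyset_\delta=\emptyset$), and for $\varepsilon>0$ let $\Gamma_\varepsilon=K_\varepsilon\setminus\operatorname{int}K_{\varepsilon/2}$. For a rational function $r=p/q$, where $p,q\in\mathbb C[z]$ have no common roots and $q\neq0$, let $V_r=\{z\in\mathbb C : |r(z)|\le1\}$, where $|r(z)|=\infty$ at the poles of $r$, so that no pole belongs to $V_r$. For every compact $K\subset\mathbb C$ and every $\varepsilon>0$ there exists a rational function $r=p/q$ as above such that $$K\subset\operatorname{int}V_r\qquad\text{and}\qquad V_r\cap\Gamma_\varepsilon=\emptyset .$$ Moreover, $r$ can be chosen so that in addition $\deg q<\deg p$. -/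

import Mathlib

/-- The rational lemniscate set `V_r = {z ∈ ℂ : |r(z)| ≤ 1}`. The numerator and the denominator of
a `RatFunc` are coprime, so the zeros of the denominator are the poles of `r`. At a pole `|r|` is
infinite (whereas `RatFunc.eval` returns the junk value `0`), hence poles are excluded. -/
noncomputable def lemniscateSet (r : RatFunc ℂ) : Set ℂ :=
  {z | r.denom.eval z ≠ 0 ∧ ‖r.eval (RingHom.id ℂ) z‖ ≤ 1}

/-- The belt `Γ_ε = K_ε \ int K_{ε/2}` around `K`, with `K_δ = {z : dist(z, K) ≤ δ}`. -/
def belt (K : Set ℂ) (ε : ℝ) : Set ℂ :=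
  Metric.cthickening ε K \ interior (Metric.cthickening (ε / 2) K)

/-! `K` and its belt are disjoint compact sets, so a smooth compactly supported cutoff `χ` is 0 near
`K` and 1 near the belt, and `dbar χ` vanishes near both. By Cauchy–Pompeiu
(`integral_dbar_div_sub`), `χ z` is `-1/π` times the integral over `w` of `dbar χ w / (w - z)`. This
superposes functions of `z` whose only pole `w` lies off both sets, so `χ` is a uniform limit there
of rational functions (`exists_rational_approx`). Doubling an approximant and adding a small
multiple of a high power of `z` separates the moduli by 1 and creates the pole at infinity. -/

open MeasureTheory Set Filter Topology

/-! ### The Cauchy–Pompeiu formula -/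

/-- The Wirtinger derivative `∂f/∂z̄`. -/
noncomputable def dbar (f : ℂ → ℂ) (w : ℂ) : ℂ :=
  (fderiv ℝ f w 1 + Complex.I * fderiv ℝ f w Complex.I) / 2

/-- Rotating the frame to the radial and angular directions produces the factor `exp (θ * I)`, which
cancels the phase of `w` in `dbar f w / w`. -/
lemma dbar_eq_polar (f : ℂ → ℂ) (w : ℂ) (θ : ℝ) :
    dbar f w = Complex.exp (θ * Complex.I) *
      ((1 / 2) * fderiv ℝ f w (Complex.exp (θ * Complex.I)) +
        (Complex.I / 2) * fderiv ℝ f w (Complex.exp (θ * Complex.I) * Complex.I)) := by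
  have key : ∀ v : ℂ, fderiv ℝ f w v = v.re * fderiv ℝ f w 1 + v.im * fderiv ℝ f w Complex.I := by
    intro v
    have : v = v.re • (1 : ℂ) + v.im • Complex.I := by simp [Complex.re_add_im]
    conv_lhs => rw [this]
    rw [map_add, map_smul, map_smul]; simp
  have h1 : Complex.exp (θ * Complex.I) = Real.cos θ + Real.sin θ * Complex.I := by
    rw [Complex.exp_mul_I]; simp
  have hcs : (Real.cos θ : ℂ) ^ 2 + (Real.sin θ : ℂ) ^ 2 = 1 := by
    exact_mod_cast Real.cos_sq_add_sin_sq θ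
  rw [dbar, key (Complex.exp _), key (Complex.exp _ * _), h1]
  simp only [Complex.add_re, Complex.add_im, Complex.mul_re, Complex.mul_im, Complex.ofReal_re,
    Complex.ofReal_im, Complex.I_re, Complex.I_im]
  push_cast at hcs ⊢
  generalize fderiv ℝ f w 1 = a at *
  generalize fderiv ℝ f w Complex.I = b at *
  generalize Complex.cos θ = c at *
  generalize Complex.sin θ = s at *
  have hI := Complex.I_sq
  generalize Complex.I = i at *
  linear_combination (-(a + i * b) / 2) * hcs + (a * s ^ 2 / 2) * hI -
    (s * c * b / 2) * hI

lemma ContDiff.continuous_dbar {f : ℂ → ℂ} (hf : ContDiff ℝ 1 f) : Continuous (dbar f) := by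
  have := hf.continuous_fderiv one_ne_zero
  unfold dbar
  fun_prop

lemma HasCompactSupport.exists_forall_norm_lt {f : ℂ → ℂ} (hc : HasCompactSupport f) :
    ∃ R : ℝ, ∀ w, R < ‖w‖ → w ∉ tsupport f := by
  obtain ⟨R, -, h⟩ := hc.isBounded.exists_pos_norm_le
  exact ⟨R, fun w hw hm => (h w hm).not_gt hw⟩

lemma integral_Ioi_fderiv_radial {f : ℂ → ℂ} (hf : ContDiff ℝ 1 f) (hc : HasCompactSupport f)
    (θ : ℝ) :
    ∫ r in Ioi (0 : ℝ), fderiv ℝ f (r * Complex.exp (θ * Complex.I))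
      (Complex.exp (θ * Complex.I)) = - f 0 := by
  obtain ⟨R, hR⟩ := hc.exists_forall_norm_lt
  have hg : ContDiff ℝ 1 (fun r : ℝ => f (r * Complex.exp (θ * Complex.I))) :=
    hf.comp (Complex.ofRealCLM.contDiff.mul contDiff_const)
  have hgc : HasCompactSupport (fun r : ℝ => f (r * Complex.exp (θ * Complex.I))) := by
    refine HasCompactSupport.intro (isCompact_Icc (a := -R) (b := R)) fun r hr => ?_
    refine image_eq_zero_of_notMem_tsupport (hR _ ?_)
    rw [norm_mul, Complex.norm_exp_ofReal_mul_I, mul_one, Complex.norm_real, Real.norm_eq_abs]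
    by_contra h
    exact hr (abs_le.1 (not_lt.1 h))
  have := hgc.integral_Ioi_deriv_eq hg 0
  simp only [Complex.ofReal_zero, zero_mul] at this
  rw [← this]
  refine integral_congr_ae (ae_of_all _ fun r => ?_)
  have h1 : HasDerivAt (fun r : ℝ => (r : ℂ) * Complex.exp (θ * Complex.I))
      (1 * Complex.exp (θ * Complex.I)) r := (Complex.ofRealCLM.hasDerivAt).mul_const _
  have h2 := ((hf.differentiable one_ne_zero _).hasFDerivAt.comp_hasDerivAt r h1).deriv
  rw [one_mul] at h2
  exact h2.symm

lemma integral_Ioo_fderiv_angular {f : ℂ → ℂ} (hf : ContDiff ℝ 1 f) {r : ℝ} (hr : 0 < r) :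
    ∫ θ in Ioo (-Real.pi) Real.pi, fderiv ℝ f (r * Complex.exp (θ * Complex.I))
      (Complex.exp (θ * Complex.I) * Complex.I) = 0 := by
  have hd : ∀ θ : ℝ, HasDerivAt (fun θ : ℝ => f (r * Complex.exp (θ * Complex.I)))
      (r • fderiv ℝ f (r * Complex.exp (θ * Complex.I))
        (Complex.exp (θ * Complex.I) * Complex.I)) θ := by
    intro θ
    have h1 : HasDerivAt (fun θ : ℝ => (r : ℂ) * Complex.exp (θ * Complex.I))
        (r * (Complex.exp (θ * Complex.I) * (1 * Complex.I))) θ :=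
      (((Complex.ofRealCLM.hasDerivAt).mul_const Complex.I).cexp).const_mul _
    have h2 := (hf.differentiable one_ne_zero _).hasFDerivAt.comp_hasDerivAt θ h1
    rw [one_mul, ← Complex.real_smul (z := Complex.exp (θ * Complex.I) * Complex.I),
      map_smul] at h2
    exact h2
  have hcont : Continuous fun θ : ℝ => r • fderiv ℝ f (r * Complex.exp (θ * Complex.I))
        (Complex.exp (θ * Complex.I) * Complex.I) := by
    have := hf.continuous_fderiv one_ne_zero
    fun_prop
  have h := intervalIntegral.integral_eq_sub_of_hasDerivAt (fun θ _ => hd θ)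
    (hcont.intervalIntegrable (-Real.pi) Real.pi)
  rw [intervalIntegral.integral_smul, intervalIntegral.integral_of_le (by linarith [Real.pi_pos]),
    integral_Ioc_eq_integral_Ioo] at h
  have h0 : f (r * Complex.exp ((Real.pi : ℝ) * Complex.I)) -
      f (r * Complex.exp ((-Real.pi : ℝ) * Complex.I)) = 0 := by
    rw [sub_eq_zero]; congr 2
    rw [Complex.exp_eq_exp_iff_exists_int]
    exact ⟨1, by push_cast; ring⟩
  rw [h0] at h
  exact (smul_eq_zero.1 h).resolve_left hr.ne'

/-- In polar coordinates the Jacobian cancels the singularity. Each ray contributes `-f 0` by the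
fundamental theorem of calculus, and each circle contributes 0 by periodicity. -/
lemma integral_dbar_div {f : ℂ → ℂ} (hf : ContDiff ℝ 1 f) (hc : HasCompactSupport f) :
    ∫ w, dbar f w / w = - Real.pi * f 0 := by
  obtain ⟨R, hR⟩ := hc.exists_forall_norm_lt
  have hcont := hf.continuous_fderiv one_ne_zero
  have hint : ∀ u : ℝ × ℝ → ℂ, Continuous u → IntegrableOn
      (fun p : ℝ × ℝ => fderiv ℝ f (p.1 * Complex.exp (p.2 * Complex.I)) (u p))
      (Ioi (0 : ℝ) ×ˢ Ioo (-Real.pi) Real.pi) := by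
    intro u hu
    refine IntegrableOn.of_forall_sdiff_eq_zero
      (s := Icc 0 R ×ˢ Icc (-Real.pi) Real.pi) ?_
      (measurableSet_Ioi.prod measurableSet_Ioo) ?_
    · refine ContinuousOn.integrableOn_compact (isCompact_Icc.prod isCompact_Icc) ?_
      exact Continuous.continuousOn (by fun_prop)
    · rintro ⟨r, θ⟩ ⟨⟨h1, h2⟩, h3⟩
      have hr : R < r := by
        by_contra h
        exact h3 ⟨⟨le_of_lt h1, not_lt.1 h⟩, Ioo_subset_Icc_self h2⟩
      have : fderiv ℝ f (r * Complex.exp (θ * Complex.I)) = 0 := by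
        refine image_eq_zero_of_notMem_tsupport fun hm => hR _ ?_ (tsupport_fderiv_subset ℝ hm)
        rw [norm_mul, Complex.norm_exp_ofReal_mul_I, mul_one, Complex.norm_real,
          Real.norm_eq_abs]
        exact hr.trans_le (le_abs_self r)
      simp [this]
  have hi1 := hint (fun p => Complex.exp (p.2 * Complex.I)) (by fun_prop)
  have hi2 := hint (fun p => Complex.exp (p.2 * Complex.I) * Complex.I) (by fun_prop)
  rw [← Complex.integral_comp_polarCoord_symm, polarCoord_target]
  have hE : ∫ p in Ioi (0 : ℝ) ×ˢ Ioo (-Real.pi) Real.pi,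
      p.1 • (dbar f (Complex.polarCoord.symm p) / Complex.polarCoord.symm p) =
      ∫ p in Ioi (0 : ℝ) ×ˢ Ioo (-Real.pi) Real.pi,
      ((1 / 2 : ℂ) * fderiv ℝ f (p.1 * Complex.exp (p.2 * Complex.I))
        (Complex.exp (p.2 * Complex.I)) +
      (Complex.I / 2) * fderiv ℝ f (p.1 * Complex.exp (p.2 * Complex.I))
        (Complex.exp (p.2 * Complex.I) * Complex.I)) := by
    refine setIntegral_congr_fun (measurableSet_Ioi.prod measurableSet_Ioo) ?_
    rintro ⟨r, θ⟩ ⟨hr, -⟩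
    have hr' : (r : ℂ) ≠ 0 := Complex.ofReal_ne_zero.2 (ne_of_gt hr)
    have he := Complex.exp_ne_zero (θ * Complex.I)
    have hs : Complex.polarCoord.symm (r, θ) = r * Complex.exp (θ * Complex.I) := by
      rw [Complex.polarCoord_symm_apply, Complex.exp_mul_I]; simp
    simp only [hs]
    rw [dbar_eq_polar f _ θ, Complex.real_smul]
    field_simp
  rw [hE, integral_add (hi1.const_mul _) (hi2.const_mul _), integral_const_mul,
    integral_const_mul]
  have h1 : ∫ p in Ioi (0 : ℝ) ×ˢ Ioo (-Real.pi) Real.pi,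
      fderiv ℝ f (p.1 * Complex.exp (p.2 * Complex.I)) (Complex.exp (p.2 * Complex.I)) =
      - (2 * Real.pi) * f 0 := by
    rw [Measure.volume_eq_prod, setIntegral_prod _ hi1, integral_integral_swap]
    · simp only [integral_Ioi_fderiv_radial hf hc]
      simp [Real.pi_pos.le, two_mul]
      ring
    · rw [Measure.prod_restrict]; exact hi1
  have h2 : ∫ p in Ioi (0 : ℝ) ×ˢ Ioo (-Real.pi) Real.pi,
      fderiv ℝ f (p.1 * Complex.exp (p.2 * Complex.I))
        (Complex.exp (p.2 * Complex.I) * Complex.I) = 0 := by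
    rw [Measure.volume_eq_prod, setIntegral_prod _ hi2]
    rw [setIntegral_congr_fun measurableSet_Ioi
      (fun r hr => integral_Ioo_fderiv_angular hf hr)]
    simp
  rw [h1, h2]; ring

/-- The **Cauchy–Pompeiu formula** for compactly supported functions. -/
theorem integral_dbar_div_sub {f : ℂ → ℂ} (hf : ContDiff ℝ 1 f) (hc : HasCompactSupport f)
    (z : ℂ) : ∫ w, dbar f w / (w - z) = - Real.pi * f z := by
  have h := integral_dbar_div (f := fun w => f (w + z)) (hf.comp (contDiff_id.add contDiff_const))
    (hc.comp_homeomorph (Homeomorph.addRight z))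
  have hd : ∀ w, dbar (fun w => f (w + z)) w = dbar f (w + z) := fun w => by
    simp only [dbar, fderiv_comp_add_right]
  simp only [hd, zero_add] at h
  rw [← h, ← integral_add_right_eq_self _ z]
  simp

/-! ### Uniform rational approximation -/

/-- The continuous functions on `L` that are quotients of polynomials without poles on `L`. -/
def rationalSubmodule (L : Set ℂ) : Submodule ℂ C(L, ℂ) where
  carrier := {g | ∃ p q : Polynomial ℂ, (∀ z ∈ L, q.eval z ≠ 0) ∧
    ∀ z : L, g z = p.eval (z : ℂ) / q.eval (z : ℂ)}
  zero_mem' := ⟨0, 1, by simp, by simp⟩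
  add_mem' := by
    rintro g h ⟨p, q, hq, hg⟩ ⟨p', q', hq', hh⟩
    refine ⟨p * q' + q * p', q * q', fun z hz => ?_, fun z => ?_⟩
    · simpa using ⟨hq z hz, hq' z hz⟩
    · rw [ContinuousMap.add_apply, hg, hh, div_add_div _ _ (hq z z.2) (hq' z z.2)]
      simp
  smul_mem' := by
    rintro c g ⟨p, q, hq, hg⟩
    refine ⟨Polynomial.C c * p, q, hq, fun z => ?_⟩
    rw [ContinuousMap.smul_apply, hg, Polynomial.eval_mul, Polynomial.eval_C, smul_eq_mul,
      mul_div_assoc]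

/-- The closure is itself a Banach space, so the integral can be formed inside it; this replaces
Riemann sums. -/
lemma integral_mem_topologicalClosure_of_continuous {E : Type*} [NormedAddCommGroup E]
    [NormedSpace ℂ E] [CompleteSpace E] (S : Submodule ℂ E) {F : ℂ → E} (hF : Continuous F)
    (hc : HasCompactSupport F) (hS : ∀ w, F w ∈ S) : ∫ w, F w ∈ S.topologicalClosure := by
  let T := S.topologicalClosure
  have : CompleteSpace T := S.isClosed_topologicalClosure.completeSpace_coe
  let G : ℂ → T := fun w => ⟨F w, S.le_topologicalClosure (hS w)⟩
  have hG : Continuous G := hF.subtype_mk _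
  have hGc : HasCompactSupport G := by
    refine HasCompactSupport.intro hc fun w hw => Subtype.ext ?_
    exact image_eq_zero_of_notMem_tsupport (f := F) hw
  have h := T.subtypeL.integral_comp_comm (hG.integrable_of_hasCompactSupport hGc (μ := volume))
  change ∫ w, F w = _ at h
  rw [h]
  exact (∫ w, G w).2

/-- A smooth compactly supported function that is holomorphic near a compact set `L` is uniformly
approximated on `L` by rational functions. -/
theorem exists_rational_approx {L : Set ℂ} (hL : IsCompact L) {f : ℂ → ℂ} (hf : ContDiff ℝ 1 f)
    (hc : HasCompactSupport f) (hd : ∀ z ∈ L, ∀ᶠ w in 𝓝 z, dbar f w = 0) {η : ℝ} (hη : 0 < η) :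
    ∃ p q : Polynomial ℂ, (∀ z ∈ L, q.eval z ≠ 0) ∧
      ∀ z ∈ L, ‖p.eval z / q.eval z - f z‖ < η := by
  have : CompactSpace L := isCompact_iff_compactSpace.1 hL
  -- The kernel has no singularity on the diagonal: `dbar f` vanishes near every point of `L`, and
  -- `0 / 0 = 0`.
  have hk : Continuous fun x : ℂ × L => dbar f x.1 / (x.1 - x.2) := by
    rw [continuous_iff_continuousAt]
    rintro ⟨w, z⟩
    by_cases hwz : w = z
    · subst hwz
      refine (continuousAt_const (y := (0 : ℂ))).congr ?_
      filter_upwards [continuousAt_fst.eventually (hd z z.2)] with x hx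
      simp [hx]
    · exact ContinuousAt.div (hf.continuous_dbar.comp continuous_fst).continuousAt
        (by fun_prop) (sub_ne_zero.2 hwz)
  let F : C(ℂ, C(L, ℂ)) := ContinuousMap.curry ⟨_, hk⟩
  have hFa : ∀ w (z : L), F w z = dbar f w / (w - z) := fun w z => rfl
  have hFc : HasCompactSupport F := by
    refine HasCompactSupport.intro hc fun w hw => ContinuousMap.ext fun z => ?_
    have : fderiv ℝ f w = 0 :=
      image_eq_zero_of_notMem_tsupport fun hm => hw (tsupport_fderiv_subset ℝ hm)
    simp [hFa, dbar, this]
  have hFS : ∀ w, F w ∈ rationalSubmodule L := by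
    intro w
    by_cases hw : w ∈ L
    · have : F w = 0 := ContinuousMap.ext fun z => by simp [hFa, (hd w hw).self_of_nhds]
      rw [this]; exact zero_mem _
    · refine ⟨Polynomial.C (dbar f w), Polynomial.C w - Polynomial.X, fun z hz => ?_,
        fun z => by simp [hFa]⟩
      simpa [sub_eq_zero] using fun h : w = z => hw (h ▸ hz)
  have hm := integral_mem_topologicalClosure_of_continuous _ F.continuous hFc hFS
  have hFi := F.continuous.integrable_of_hasCompactSupport hFc (μ := volume)
  have hev : ∀ z : L, (∫ w, F w) z = - Real.pi * f z := by
    intro z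
    rw [← integral_dbar_div_sub hf hc z]
    exact ((ContinuousMap.evalCLM ℂ z).integral_comp_comm hFi).symm
  have hpi : (-(Real.pi : ℂ)) ≠ 0 := neg_ne_zero.2 (Complex.ofReal_ne_zero.2 Real.pi_ne_zero)
  have hm' := (rationalSubmodule L).topologicalClosure.smul_mem (-(Real.pi : ℂ))⁻¹ hm
  obtain ⟨g, ⟨p, q, hq, hg⟩, hgd⟩ := Metric.mem_closure_iff.1 hm' η hη
  refine ⟨p, q, hq, fun z hz => ?_⟩
  have h := (ContinuousMap.dist_lt_iff hη).1 hgd ⟨z, hz⟩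
  rwa [ContinuousMap.smul_apply, hev, hg, smul_eq_mul, inv_mul_cancel_left₀ hpi, dist_comm,
    dist_eq_norm] at h

/-! ### Rational separation of disjoint compact sets -/

lemma dbar_eventually_eq_zero {f : ℂ → ℂ} {z c : ℂ} (h : ∀ᶠ w in 𝓝 z, f w = c) :
    ∀ᶠ w in 𝓝 z, dbar f w = 0 := by
  have h' : f =ᶠ[𝓝 z] fun _ => c := h
  filter_upwards [h'.fderiv (𝕜 := ℝ)] with w hw
  simp [dbar, hw]

/-- Disjoint compact sets are separated by a rational function without poles on them. -/
theorem exists_rational_separating {A B : Set ℂ} (hA : IsCompact A) (hB : IsCompact B)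
    (hAB : Disjoint A B) {η : ℝ} (hη : 0 < η) :
    ∃ p q : Polynomial ℂ, (∀ z ∈ A ∪ B, q.eval z ≠ 0) ∧
      (∀ z ∈ A, ‖p.eval z / q.eval z‖ < η) ∧ ∀ z ∈ B, ‖p.eval z / q.eval z - 1‖ < η := by
  obtain ⟨R, hR⟩ := hB.isBounded.subset_ball 0
  -- Making the cutoff vanish outside a ball as well gives it compact support.
  have hs : IsClosed (A ∪ (Metric.ball 0 R)ᶜ) :=
    hA.isClosed.union Metric.isOpen_ball.isClosed_compl
  have hd : Disjoint (A ∪ (Metric.ball 0 R)ᶜ) B :=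
    hAB.union_left (disjoint_compl_left_iff_subset.2 hR)
  obtain ⟨χ, h0, h1, -⟩ := exists_contMDiffMap_zero_one_nhds_of_isClosed
    (modelWithCornersSelf ℝ ℂ) (n := 1) hs hB.isClosed hd
  have hχ : ContDiff ℝ 1 χ := χ.contMDiff.contDiff
  have h0' := eventually_nhdsSet_iff_forall.1 h0
  have h1' := eventually_nhdsSet_iff_forall.1 h1
  have hA0 : ∀ z ∈ A, ∀ᶠ w in 𝓝 z, (χ w : ℂ) = 0 := fun z hz =>
    (h0' z (Or.inl hz)).mono fun w hw => by simp [hw]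
  have hB1 : ∀ z ∈ B, ∀ᶠ w in 𝓝 z, (χ w : ℂ) = 1 := fun z hz =>
    (h1' z hz).mono fun w hw => by simp [hw]
  have hc : HasCompactSupport fun z => (χ z : ℂ) := by
    refine HasCompactSupport.intro (isCompact_closedBall (0 : ℂ) R) fun z hz => ?_
    have : z ∉ Metric.ball 0 R := fun h => hz (Metric.ball_subset_closedBall h)
    simp [(h0' z (Or.inr this)).self_of_nhds]
  obtain ⟨p, q, hq, hpq⟩ := exists_rational_approx (hA.union hB)
    (f := fun z => (χ z : ℂ)) (Complex.ofRealCLM.contDiff.comp hχ) hc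
    (fun z hz => hz.elim (fun h => dbar_eventually_eq_zero (hA0 z h))
      (fun h => dbar_eventually_eq_zero (hB1 z h))) hη
  refine ⟨p, q, hq, fun z hz => ?_, fun z hz => ?_⟩
  · have := hpq z (Or.inl hz)
    rwa [(hA0 z hz).self_of_nhds, sub_zero] at this
  · have := hpq z (Or.inr hz)
    rwa [(hB1 z hz).self_of_nhds] at this

/-- The separating rational function can be chosen with a pole at infinity. -/
theorem exists_rational_separating_natDegree_lt {A B : Set ℂ} (hA : IsCompact A)
    (hB : IsCompact B) (hAB : Disjoint A B) :
    ∃ p q : Polynomial ℂ, (∀ z ∈ A ∪ B, q.eval z ≠ 0) ∧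
      (∀ z ∈ A, ‖p.eval z / q.eval z‖ < 1) ∧ (∀ z ∈ B, 1 < ‖p.eval z / q.eval z‖) ∧
      q ≠ 0 ∧ q.natDegree < p.natDegree := by
  -- After doubling, the error is below 1/4; with a perturbation of at most 1/4, the modulus is
  -- below 1/2 on `A` and above 3/2 on `B`.
  obtain ⟨p, q, hq, hpA, hpB⟩ := exists_rational_separating hA hB hAB (η := 1 / 8) (by norm_num)
  -- `q = 0` is possible only if `A ∪ B` is empty.
  wlog hq0 : q ≠ 0 generalizing p q
  · have hempty : ∀ z, z ∉ A ∪ B := fun z hz => hq z hz (by simp [not_not.1 hq0])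
    exact this 0 1 (by simp) (fun z hz => (hempty z (Or.inl hz)).elim)
      (fun z hz => (hempty z (Or.inr hz)).elim) one_ne_zero
  -- With this `n`, the term `δ * X ^ n * q` has degree above those of both `p` and `q`.
  set n := p.natDegree + 1
  obtain ⟨C, hC⟩ := ((hA.union hB).image (continuous_pow n)).isBounded.exists_pos_norm_le
  obtain ⟨hC0, hC⟩ := hC
  set δ : ℂ := ((1 / (4 * C) : ℝ) : ℂ) with hδ
  have hδ0 : δ ≠ 0 := Complex.ofReal_ne_zero.2 (by positivity)
  have hsmall : ∀ z ∈ A ∪ B, ‖δ * z ^ n‖ ≤ 1 / 4 := by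
    intro z hz
    have h1 := hC _ (mem_image_of_mem _ hz)
    have h2 : ‖δ‖ = 1 / (4 * C) := by
      rw [hδ, Complex.norm_real, Real.norm_of_nonneg (by positivity)]
    calc ‖δ * z ^ n‖ = 1 / (4 * C) * ‖z ^ n‖ := by rw [norm_mul, h2]
      _ ≤ 1 / (4 * C) * C := by gcongr
      _ = 1 / 4 := by field_simp
  have hev : ∀ z ∈ A ∪ B, (Polynomial.C 2 * p + Polynomial.C δ * Polynomial.X ^ n * q).eval z /
      q.eval z = 2 * (p.eval z / q.eval z) + δ * z ^ n := by
    intro z hz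
    have := hq z hz
    simp; field_simp
  refine ⟨Polynomial.C 2 * p + Polynomial.C δ * Polynomial.X ^ n * q, q, hq, ?_, ?_, hq0, ?_⟩
  · intro z hz
    rw [hev z (Or.inl hz)]
    calc _ ≤ ‖2 * (p.eval z / q.eval z)‖ + ‖δ * z ^ n‖ := norm_add_le _ _
      _ = 2 * ‖p.eval z / q.eval z‖ + ‖δ * z ^ n‖ := by rw [norm_mul]; simp
      _ < 1 := by linarith [hpA z hz, hsmall z (Or.inl hz)]
  · intro z hz
    rw [hev z (Or.inr hz)]
    have h : (2 : ℂ) = (2 * (p.eval z / q.eval z) + δ * z ^ n) -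
      2 * (p.eval z / q.eval z - 1) - δ * z ^ n := by ring
    have h2 : (2 : ℝ) ≤ ‖2 * (p.eval z / q.eval z) + δ * z ^ n‖ +
        2 * ‖p.eval z / q.eval z - 1‖ + ‖δ * z ^ n‖ := by
      calc (2 : ℝ) = ‖(2 : ℂ)‖ := by simp
        _ ≤ _ := by
          conv_lhs => rw [h]
          refine (norm_sub_le _ _).trans (add_le_add_left ((norm_sub_le _ _).trans ?_) _)
          rw [norm_mul 2]; simp
    linarith [hpB z hz, hsmall z (Or.inr hz)]
  · have hd : (Polynomial.C δ * Polynomial.X ^ n * q).natDegree = n + q.natDegree := by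
      rw [Polynomial.natDegree_mul (by simp [hδ0]) hq0, Polynomial.natDegree_C_mul_X_pow _ _ hδ0]
    have hlt : (Polynomial.C 2 * p).natDegree <
        (Polynomial.C δ * Polynomial.X ^ n * q).natDegree := by
      rw [hd]
      exact (Polynomial.natDegree_C_mul_le _ _).trans_lt (by omega)
    rw [Polynomial.natDegree_add_eq_right_of_natDegree_lt hlt, hd]
    omega

/-! ### Passage to reduced fractions -/

/-- `p` and `q` may share factors, but the reduced denominator divides `q`, so cancellation creates
no new pole. -/
lemma RatFunc.eval_denom_ne_zero_and_eval_div {p q : Polynomial ℂ} {z : ℂ}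
    (hz : q.eval z ≠ 0) :
    (algebraMap _ (RatFunc ℂ) p / algebraMap _ (RatFunc ℂ) q).denom.eval z ≠ 0 ∧
      (algebraMap _ (RatFunc ℂ) p / algebraMap _ (RatFunc ℂ) q).eval (RingHom.id ℂ) z =
        p.eval z / q.eval z := by
  have hq : q ≠ 0 := fun h => hz (by simp [h])
  have hd : (algebraMap _ (RatFunc ℂ) p / algebraMap _ (RatFunc ℂ) q).denom.eval z ≠ 0 := fun h =>
    hz (Polynomial.eval_eq_zero_of_dvd_of_eval_eq_zero (RatFunc.denom_div_dvd p q) h)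
  refine ⟨hd, ?_⟩
  have h := RatFunc.eval_mul (RingHom.id ℂ) z hd (y := algebraMap _ (RatFunc ℂ) q) (by simp)
  rw [div_mul_cancel₀ _ (RatFunc.algebraMap_ne_zero hq)] at h
  rw [eq_div_iff hz]
  simpa [Polynomial.eval₂_id] using h.symm

theorem theorem2p1 (K : Set ℂ) (hK : IsCompact K) (ε : ℝ) (hε : 0 < ε) :
    ∃ r : RatFunc ℂ,
      K ⊆ interior (lemniscateSet r) ∧
      Disjoint (lemniscateSet r) (belt K ε) ∧
      r.denom.natDegree < r.num.natDegree := by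
  have hB : IsCompact (belt K ε) := hK.cthickening.diff isOpen_interior
  have hKB : Disjoint K (belt K ε) := by
    refine disjoint_sdiff_right.mono_left ?_
    exact (Metric.self_subset_thickening (half_pos hε) K).trans
      (interior_maximal (Metric.thickening_subset_cthickening _ _) Metric.isOpen_thickening)
  obtain ⟨p, q, hq, hpK, hpB, hq0, hdeg⟩ := exists_rational_separating_natDegree_lt hK hB hKB
  refine ⟨algebraMap _ (RatFunc ℂ) p / algebraMap _ (RatFunc ℂ) q, ?_, ?_, ?_⟩
  · have ho : IsOpen {z : ℂ | q.eval z ≠ 0 ∧ ‖p.eval z‖ < ‖q.eval z‖} :=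
      (isOpen_ne_fun q.continuous continuous_const).inter
        (isOpen_lt p.continuous.norm q.continuous.norm)
    refine fun z hz => interior_maximal ?_ ho ⟨hq z (Or.inl hz), ?_⟩
    · rintro w ⟨hw, hpw⟩
      obtain ⟨h1, h2⟩ := RatFunc.eval_denom_ne_zero_and_eval_div (p := p) hw
      refine ⟨h1, ?_⟩
      rw [h2, norm_div]
      exact div_le_one_of_le₀ hpw.le (norm_nonneg _)
    · have h := hpK z hz
      rwa [norm_div, div_lt_one (norm_pos_iff.2 (hq z (Or.inl hz)))] at h
  · refine disjoint_left.2 fun z hz hzB => (hpB z hzB).not_ge ?_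
    rw [← (RatFunc.eval_denom_ne_zero_and_eval_div (p := p) (hq z (Or.inr hzB))).2]
    exact hz.2
  · have hp0 : p ≠ 0 := fun h => by simp [h] at hdeg
    -- The degree difference is unchanged by cancelling common factors.
    have h := RatFunc.intDegree_div (RatFunc.algebraMap_ne_zero hp0)
      (RatFunc.algebraMap_ne_zero hq0)
    rw [RatFunc.intDegree_polynomial, RatFunc.intDegree_polynomial, RatFunc.intDegree] at h
    omega
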